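/- Let $G=(V,E)$ be any simple graph, finite or infinite. Let $k$ be a natural number, and let every vertex $v\in V$ be given a list $L_v\subseteq\{1,\dots,k\}$ with at least two elements and every edge $e\in E$ a list $L_e\subseteq\{1,\dots,k\}$ with at least three elements. For a function $\omega\colon V\cup E\to\mathbb N$, define the weighted degree of a vertex $v$ as the cardinal number $s_\omega(v)=\omega(v)+\sum_{w\in N(v)}\omega(vw)$, where $N(v)$ is the set of neighbours of $v$. Then there is a function $\omega$ with $\omega(v)\in L_v$ for every vertex $v$ and $\omega(e)\in L_e$ for every edge $e$, such that for every edge $uv$ of $G$ either $s_\omega(u)\neq s_\omega(v)$, or $u$ and $v$ have the same infinite degree. -/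

import Mathlib

open Cardinal

universe u

namespace ListWeighting

variable {V : Type u} (G : SimpleGraph V)

/-- The degree of `v`, as a cardinal. -/
noncomputable def degree (v : V) : Cardinal.{u} := #(G.neighborSet v)

/-- The weighted degree of `v` under a total weighting, given by vertex weights `ωV` and edge
weights `ωE`: the cardinal `∑_{w ∈ N(v)} ωE(vw) + ωV(v)`. -/
noncomputable def weightedDegree (ωV : V → ℕ) (ωE : G.edgeSet → ℕ) (v : V) : Cardinal.{u} :=
  Cardinal.sum (fun w : G.neighborSet v =>
    (ωE ⟨s(v, w.1), (G.mem_edgeSet).2 w.2⟩ : Cardinal.{u})) + (ωV v : Cardinal.{u})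

/-- `ωV`, `ωE` is a total weighting of `G` from the lists `LV`, `LE`. -/
def IsWeightingFrom (LV : V → Finset ℕ) (LE : G.edgeSet → Finset ℕ)
    (ωV : V → ℕ) (ωE : G.edgeSet → ℕ) : Prop :=
  (∀ v, ωV v ∈ LV v) ∧ ∀ e, ωE e ∈ LE e

/-- The endpoints of every edge have different weighted degrees, or the same infinite degree. -/
def IsDistinguishing (ωV : V → ℕ) (ωE : G.edgeSet → ℕ) : Prop :=
  ∀ u v : V, G.Adj u v →
    weightedDegree G ωV ωE u ≠ weightedDegree G ωV ωE v ∨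
      (degree G u = degree G v ∧ ℵ₀ ≤ degree G u)

/-- `G` has a distinguishing total weighting from the lists `LV`, `LE`. -/
def HasListWeighting (LV : V → Finset ℕ) (LE : G.edgeSet → Finset ℕ) : Prop :=
  ∃ (ωV : V → ℕ) (ωE : G.edgeSet → ℕ),
    IsWeightingFrom G LV LE ωV ωE ∧ IsDistinguishing G ωV ωE

end ListWeighting

/-! For a finite graph, take a variable for each vertex and edge and let `s_u` be the linear form of
the weighted degree. By the Combinatorial Nullstellensatz it is enough that some multiple of every
`s_u - s_v`, `uv` an edge, has a top-degree monomial with exponents at most 1 at vertices and 2 at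
edges. Products of these differences satisfy `∂_{uv} = ∂_u + ∂_v`, which lets exponents be exchanged
between an edge and its ends (`IsBalanced.coeff_add`). `exists_coeff_ne_zero` adds vertices one at a
time. The new factors put the exponent `|T|` on the new vertex `v`, where `T` is its set of earlier
neighbours. Exponents on `T` are pushed to the edges at `v`, and then each unit on `v` goes to a
different `u ∈ T` or to its edge `vu`. For infinite graphs, Rado selection handles the vertices of
finite degree. Weights are positive and finite, so the weighted degree of a vertex of infinite
degree is its degree. -/

namespace ListWeighting

open MvPolynomial Finsupp

/-! ### Balanced polynomials and the linear forms of weighted degrees -/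

section Polynomial

variable {V : Type*} (G : SimpleGraph V)

/-- The derivative along an edge is the sum of the derivatives along its endpoints. -/
def IsBalanced (F : MvPolynomial (V ⊕ Sym2 V) ℚ) : Prop :=
  ∀ u v, G.Adj u v →
    pderiv (Sum.inr s(u, v)) F = pderiv (Sum.inl u) F + pderiv (Sum.inl v) F

variable {G}

theorem IsBalanced.sub {E F : MvPolynomial (V ⊕ Sym2 V) ℚ} (hE : IsBalanced G E)
    (hF : IsBalanced G F) : IsBalanced G (E - F) := by
  intro u v h
  rw [map_sub, map_sub, map_sub, hE u v h, hF u v h]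
  ring

theorem IsBalanced.mul {E F : MvPolynomial (V ⊕ Sym2 V) ℚ} (hE : IsBalanced G E)
    (hF : IsBalanced G F) : IsBalanced G (E * F) := by
  intro u v h
  simp only [pderiv_mul, hE u v h, hF u v h]
  ring

theorem isBalanced_one : IsBalanced G 1 := by
  intro u v h
  simp

theorem IsBalanced.prod {ι : Type*} (T : Finset ι) (f : ι → MvPolynomial (V ⊕ Sym2 V) ℚ)
    (hf : ∀ i ∈ T, IsBalanced G (f i)) : IsBalanced G (∏ i ∈ T, f i) :=
  Finset.prod_induction _ _ (fun _ _ => IsBalanced.mul) isBalanced_one hf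

/-- The exchange rule: if exactly one term on the right is nonzero, so is the coefficient on the
left. -/
theorem IsBalanced.coeff_add {F : MvPolynomial (V ⊕ Sym2 V) ℚ} (hF : IsBalanced G F) {u v : V}
    (h : G.Adj u v) (K : V ⊕ Sym2 V →₀ ℕ) :
    coeff (K + single (Sum.inr s(u, v)) 1) F * (K (Sum.inr s(u, v)) + 1) =
      coeff (K + single (Sum.inl u) 1) F * (K (Sum.inl u) + 1) +
        coeff (K + single (Sum.inl v) 1) F * (K (Sum.inl v) + 1) := by
  rw [← coeff_pderiv, ← coeff_pderiv, ← coeff_pderiv, hF u v h, MvPolynomial.coeff_add]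

variable [Fintype V]

variable (G) in
open Classical in
/-- The weighted degree of a vertex of a finite graph, as a linear form in one variable for each
vertex and one for each pair of vertices. -/
noncomputable def vertexForm (u : V) : MvPolynomial (V ⊕ Sym2 V) ℚ :=
  X (Sum.inl u) + ∑ w with G.Adj u w, X (Sum.inr s(u, w))

/-- The variable of an edge `uv` occurs only in the forms of `u` and `v`, each time with coefficient
one. -/
theorem isBalanced_vertexForm (a : V) : IsBalanced G (vertexForm G a) := by
  classical
  intro u v huv
  have h1 : ∀ x, pderiv (Sum.inl x : V ⊕ Sym2 V) (vertexForm G a) = if x = a then 1 else 0 := by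
    intro x
    simp [vertexForm, pderiv_X, Pi.single_apply, eq_comm]
  rw [h1, h1]
  have h2 : pderiv (Sum.inr s(u, v) : V ⊕ Sym2 V) (vertexForm G a) =
      ∑ w with G.Adj a w, if s(a, w) = s(u, v) then 1 else 0 := by
    simp [vertexForm, pderiv_X, Pi.single_apply]
  rw [h2]
  by_cases hu : u = a
  · subst hu
    rw [Finset.sum_eq_single v]
    · simp [huv.ne']
    · intro b _ hb
      simp [hb, huv.ne]
    · simp [huv]
  · by_cases hv : v = a
    · subst hv
      rw [Finset.sum_eq_single u]
      · simp [huv.ne, Sym2.eq_swap]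
      · intro b _ hb
        simp [hb, huv.ne']
      · simp [huv.symm]
    · rw [Finset.sum_eq_zero]
      · simp [hu, hv]
      · intro b _
        rw [if_neg]
        simp only [Sym2.eq_iff]
        rintro (⟨h, -⟩ | ⟨h, -⟩)
        exacts [hu h.symm, hv h.symm]

theorem isHomogeneous_vertexForm (u : V) : (vertexForm G u).IsHomogeneous 1 :=
  (isHomogeneous_X _ _).add (IsHomogeneous.sum _ _ _ fun _ _ => isHomogeneous_X _ _)

theorem degreeOf_vertexForm_of_ne {u v : V} (h : v ≠ u) :
    degreeOf (Sum.inl v) (vertexForm G u) = 0 := by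
  classical
  refine Nat.le_zero.1 ((degreeOf_add_le _ _ _).trans (max_le ?_ ?_))
  · rw [degreeOf_X_of_ne (by simpa using h)]
  · refine (degreeOf_sum_le _ _ _).trans (Finset.sup_le fun w _ => ?_)
    rw [degreeOf_X_of_ne (by simp)]

theorem exists_vertexForm_sub {u v : V} (h : v ≠ u) :
    ∃ R, degreeOf (Sum.inl v) R = 0 ∧ vertexForm G v - vertexForm G u = X (Sum.inl v) + R := by
  classical
  refine ⟨∑ w with G.Adj v w, X (Sum.inr s(v, w)) - vertexForm G u, ?_, ?_⟩
  · refine Nat.le_zero.1 ((degreeOf_sub_le _ _ _).trans (max_le ?_ ?_))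
    · refine (degreeOf_sum_le _ _ _).trans (Finset.sup_le fun w _ => ?_)
      rw [degreeOf_X_of_ne (by simp)]
    · rw [degreeOf_vertexForm_of_ne h]
  · simp only [vertexForm]
    ring

end Polynomial

theorem coeff_eq_zero_of_degreeOf_lt {σ : Type*} {F : MvPolynomial σ ℚ} {i : σ} {K : σ →₀ ℕ}
    (h : degreeOf i F < K i) : coeff K F = 0 := by
  by_contra hK
  exact absurd (degreeOf_le_iff.1 le_rfl K (MvPolynomial.mem_support_iff.2 hK)) (not_le.2 h)

/-- The leading term in one variable of a product with factors that are monic and linear in it. -/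
theorem leading_mul_prod {σ ι : Type*} {F : MvPolynomial σ ℚ} {i : σ} (hF : degreeOf i F = 0)
    (T : Finset ι) (L : ι → MvPolynomial σ ℚ)
    (hL : ∀ t ∈ T, ∃ R, degreeOf i R = 0 ∧ L t = X i + R) :
    degreeOf i (F * ∏ t ∈ T, L t) ≤ T.card ∧
      ∀ K, coeff (K + single i T.card) (F * ∏ t ∈ T, L t) = coeff K F := by
  classical
  induction T using Finset.induction_on with
  | empty => simp [hF]
  | insert a T ha ih =>
    obtain ⟨ih1, ih2⟩ := ih fun t ht => hL t (Finset.mem_insert_of_mem ht)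
    obtain ⟨R, hR, hLa⟩ := hL a (Finset.mem_insert_self _ _)
    have e : F * ∏ t ∈ insert a T, L t =
        (F * ∏ t ∈ T, L t) * X i + (F * ∏ t ∈ T, L t) * R := by
      rw [Finset.prod_insert ha, hLa]
      ring
    rw [e, Finset.card_insert_of_notMem ha]
    have hR' : degreeOf i ((F * ∏ t ∈ T, L t) * R) ≤ T.card :=
      (degreeOf_mul_le _ _ _).trans (by omega)
    refine ⟨(degreeOf_add_le _ _ _).trans (max_le ?_ (hR'.trans (Nat.le_succ _))), fun K => ?_⟩
    · refine (degreeOf_mul_le _ _ _).trans ?_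
      rw [degreeOf_X_self]
      omega
    -- The summand with `R` has degree at most `T.card` in `i`, too small to contribute.
    · rw [MvPolynomial.coeff_add, coeff_eq_zero_of_degreeOf_lt (F := _ * R) (i := i), add_zero,
        Finsupp.single_add, ← add_assoc, coeff_mul_X, ih2]
      simp
      omega

/-! ### Moving exponents between vertices and edges -/

section Exchange

variable {V : Type*} {G : SimpleGraph V} {F : MvPolynomial (V ⊕ Sym2 V) ℚ}

/-- If the exponent of `v` is maximal, then the weight of neighbours of `v` can be moved to the
edges joining them to `v`. -/
theorem exists_coeff_ne_zero_of_neighbors (hF : IsBalanced G F) {v : V} {d : ℕ}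
    (hd : degreeOf (Sum.inl v) F ≤ d) (Z : Finset V) (hZ : ∀ u ∈ Z, G.Adj v u)
    (K : V ⊕ Sym2 V →₀ ℕ) (hK : coeff (K + single (Sum.inl v) d) F ≠ 0)
    (h1 : ∀ u ∈ Z, K (Sum.inl u) ≤ 1) (h0 : ∀ u ∈ Z, K (Sum.inr s(v, u)) = 0) :
    ∃ K' : V ⊕ Sym2 V →₀ ℕ, coeff (K' + single (Sum.inl v) d) F ≠ 0 ∧
      (∀ u ∈ Z, K' (Sum.inl u) = 0 ∧ K' (Sum.inr s(v, u)) ≤ 1) ∧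
      ∀ z, (∀ u ∈ Z, z ≠ Sum.inl u ∧ z ≠ Sum.inr s(v, u)) → K' z = K z := by
  classical
  induction Z using Finset.induction_on with
  | empty => exact ⟨K, hK, by simp, by simp⟩
  | insert a Z ha ih =>
    simp only [Finset.forall_mem_insert] at hZ h1 h0
    obtain ⟨K₁, hK₁, hZ₁, hf⟩ := ih hZ.2 h1.2 h0.2
    have ha1 : K₁ (Sum.inl a) ≤ 1 := by
      rw [hf _ fun u hu => ⟨by rintro ⟨⟩; exact ha hu, by simp⟩]
      exact h1.1
    have ha0 : K₁ (Sum.inr s(v, a)) = 0 := by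
      rw [hf _ fun u hu => ⟨by simp, ?_⟩]
      · exact h0.1
      · simp only [ne_eq, Sum.inr.injEq, Sym2.congr_right]
        rintro rfl
        exact ha hu
    rcases Nat.le_one_iff_eq_zero_or_eq_one.1 ha1 with h | h
    · refine ⟨K₁, hK₁, ?_, fun z hz => hf z fun u hu => hz u (Finset.mem_insert_of_mem hu)⟩
      simp only [Finset.forall_mem_insert]
      exact ⟨⟨h, by omega⟩, hZ₁⟩
    · obtain ⟨K₀, rfl⟩ : ∃ K₀, K₁ = K₀ + single (Sum.inl a) 1 :=
        ⟨K₁ - single (Sum.inl a) 1,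
          (tsub_add_cancel_of_le (Finsupp.single_le_iff.2 h.ge)).symm⟩
      have hav : K₀ (Sum.inl a) = 0 := by simpa using h
      have hae : K₀ (Sum.inr s(v, a)) = 0 := by simpa using ha0
      refine ⟨K₀ + single (Sum.inr s(v, a)) 1, ?_, ?_, ?_⟩
      -- The term with exponent `d + 1` at `v` vanishes, so the unit on `a` can only go to the edge
      -- `va`.
      · have key := hF.coeff_add hZ.1 (K₀ + single (Sum.inl v) d)
        rw [coeff_eq_zero_of_degreeOf_lt (i := Sum.inl v)
          (K := K₀ + single (Sum.inl v) d + single (Sum.inl v) 1)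
          (by simp only [Finsupp.add_apply, Finsupp.single_eq_same]; omega),
          zero_mul, zero_add] at key
        rw [add_right_comm] at hK₁ ⊢
        intro h0
        rw [h0, zero_mul] at key
        refine mul_ne_zero hK₁ ?_ key.symm
        positivity
      · simp only [Finset.forall_mem_insert]
        refine ⟨⟨by simpa using hav, by simp [hae]⟩, fun u hu => ?_⟩
        have hua : u ≠ a := by rintro rfl; exact ha hu
        simpa [Finsupp.single_apply, hua.symm, hZ.1.ne'] using hZ₁ u hu
      · intro z hz
        simp only [Finset.forall_mem_insert] at hz
        rw [← hf z hz.2]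
        simp [hz.1.1.symm, hz.1.2.symm]

/-- Weight on `v` can be moved to edges at `v` and their other endpoints. -/
theorem exists_coeff_ne_zero_of_vertex (hF : IsBalanced G F) {v : V} (T : Finset V)
    (hT : ∀ u ∈ T, G.Adj v u) (j : ℕ)
    (K : V ⊕ Sym2 V →₀ ℕ) (hK : coeff (K + single (Sum.inl v) (j + T.card)) F ≠ 0)
    (h1 : ∀ u ∈ T, K (Sum.inl u) = 0 ∧ K (Sum.inr s(v, u)) ≤ 1) :
    ∃ K' : V ⊕ Sym2 V →₀ ℕ, coeff (K' + single (Sum.inl v) j) F ≠ 0 ∧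
      (∀ u ∈ T, K' (Sum.inl u) ≤ 1 ∧ K' (Sum.inr s(v, u)) ≤ 2) ∧
      ∀ z, (∀ u ∈ T, z ≠ Sum.inl u ∧ z ≠ Sum.inr s(v, u)) → K' z = K z := by
  classical
  induction T using Finset.induction_on generalizing j with
  | empty => exact ⟨K, by simpa using hK, by simp, by simp⟩
  | insert a T ha ih =>
    simp only [Finset.forall_mem_insert] at hT h1
    rw [Finset.card_insert_of_notMem ha, add_comm T.card, ← add_assoc] at hK
    obtain ⟨K₁, hK₁, hT₁, hf⟩ := ih hT.2 (j + 1) hK h1.2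
    have ha0 : K₁ (Sum.inl a) = 0 := by
      rw [hf _ fun u hu => ⟨by rintro ⟨⟩; exact ha hu, by simp⟩]
      exact h1.1.1
    have ha1 : K₁ (Sum.inr s(v, a)) ≤ 1 := by
      rw [hf _ fun u hu => ⟨by simp, ?_⟩]
      · exact h1.1.2
      · simp only [ne_eq, Sum.inr.injEq, Sym2.congr_right]
        rintro rfl
        exact ha hu
    have key := hF.coeff_add hT.1 (K₁ + single (Sum.inl v) j)
    rw [Finsupp.single_add, ← add_assoc] at hK₁
    -- The coefficient with the extra unit on `v` is nonzero, so if the one with it on `a` vanishes,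
    -- the one with it on `va` does not.
    by_cases h0 : coeff (K₁ + single (Sum.inl v) j + single (Sum.inl a) 1) F = 0
    · refine ⟨K₁ + single (Sum.inr s(v, a)) 1, ?_, ?_, ?_⟩
      · rw [add_right_comm]
        intro h
        rw [h0, h, zero_mul, zero_mul, add_zero] at key
        refine mul_ne_zero hK₁ ?_ key.symm
        positivity
      · simp only [Finset.forall_mem_insert]
        refine ⟨⟨by simp [ha0], by simpa using ha1⟩, fun u hu => ?_⟩
        have hua : u ≠ a := by rintro rfl; exact ha hu
        simpa [Finsupp.single_apply, hua.symm, hT.1.ne'] using hT₁ u hu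
      · intro z hz
        simp only [Finset.forall_mem_insert] at hz
        rw [← hf z hz.2]
        simp [hz.1.2.symm]
    · refine ⟨K₁ + single (Sum.inl a) 1, ?_, ?_, ?_⟩
      · rwa [add_right_comm]
      · simp only [Finset.forall_mem_insert]
        refine ⟨⟨by simp [ha0], by simpa using ha1.trans one_le_two⟩, fun u hu => ?_⟩
        have hua : u ≠ a := by rintro rfl; exact ha hu
        simpa [Finsupp.single_apply, hua.symm] using hT₁ u hu
      · intro z hz
        simp only [Finset.forall_mem_insert] at hz
        rw [← hf z hz.2]
        simp [hz.1.1.symm]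

end Exchange

/-! ### Finite graphs: vertex-by-vertex induction and the Nullstellensatz -/

section Finite

open MvPolynomial Finsupp

variable {V : Type*} [Fintype V] (G : SimpleGraph V)

/-- The product of the differences of the weighted degrees over the edges spanned by `S` has a
monomial with exponents at most one at the vertices and at most two at the edges. -/
theorem exists_coeff_ne_zero (S : Finset V) :
    ∃ (P : MvPolynomial (V ⊕ Sym2 V) ℚ) (K : V ⊕ Sym2 V →₀ ℕ),
      (∃ n, P.IsHomogeneous n) ∧ IsBalanced G P ∧ (∀ v ∉ S, degreeOf (Sum.inl v) P = 0) ∧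
      (∀ u ∈ S, ∀ v ∈ S, G.Adj u v → vertexForm G u - vertexForm G v ∣ P) ∧
      coeff K P ≠ 0 ∧ (∀ u, K (Sum.inl u) ≤ 1) ∧ (∀ e, K (Sum.inr e) ≤ 2) ∧
      ∀ a b, K (Sum.inr s(a, b)) ≠ 0 → a ∈ S ∧ b ∈ S := by
  classical
  induction S using Finset.induction_on with
  | empty => exact ⟨1, 0, ⟨0, isHomogeneous_one _ _⟩, isBalanced_one, by simp, by simp, by simp⟩
  | insert v S hv ih =>
    obtain ⟨P, K, ⟨n, hn⟩, hbal, hdeg, hdvd, hK, hK1, hK2, hKS⟩ := ih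
    set T : Finset V := {u ∈ S | G.Adj v u}
    have hT : ∀ u ∈ T, u ∈ S ∧ G.Adj v u := fun u hu => Finset.mem_filter.1 hu
    set F := P * ∏ u ∈ T, (vertexForm G v - vertexForm G u)
    have hFbal : IsBalanced G F := hbal.mul <| IsBalanced.prod _ _ fun u _ =>
      (isBalanced_vertexForm v).sub (isBalanced_vertexForm u)
    obtain ⟨hFdeg, hFcoeff⟩ := leading_mul_prod (hdeg v hv) T
      (fun u => vertexForm G v - vertexForm G u)
      fun u hu => exists_vertexForm_sub (hT u hu).2.ne
    -- Edges at the new vertex are still unused.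
    have hK0 : ∀ u, K (Sum.inr s(v, u)) = 0 := by
      intro u
      by_contra h
      exact hv (hKS v u h).1
    obtain ⟨K₁, hK₁, h1, hf1⟩ := exists_coeff_ne_zero_of_neighbors hFbal hFdeg T
      (fun u hu => (hT u hu).2) K (by rwa [hFcoeff]) (fun u _ => hK1 u) (fun u _ => hK0 u)
    obtain ⟨K₂, hK₂, h2, hf2⟩ := exists_coeff_ne_zero_of_vertex hFbal T
      (fun u hu => (hT u hu).2) 0 K₁ (by rwa [zero_add]) h1
    have hf : ∀ z, (∀ u ∈ T, z ≠ Sum.inl u ∧ z ≠ Sum.inr s(v, u)) → K₂ z = K z :=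
      fun z hz => (hf2 z hz).trans (hf1 z hz)
    refine ⟨F, K₂, ⟨n + ∑ _u ∈ T, 1, hn.mul <| IsHomogeneous.prod _ _ _ fun u _ =>
      (isHomogeneous_vertexForm v).sub (isHomogeneous_vertexForm u)⟩, hFbal, ?_, ?_,
      by simpa using hK₂, ?_, ?_, ?_⟩
    · intro w hw
      rw [Finset.mem_insert, not_or] at hw
      refine Nat.le_zero.1 ((degreeOf_mul_le _ _ _).trans ?_)
      rw [hdeg w hw.2, zero_add]
      refine (degreeOf_prod_le _ _ _).trans (Finset.sum_nonpos fun u hu => ?_)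
      refine (degreeOf_sub_le _ _ _).trans (max_le ?_ ?_)
      · rw [degreeOf_vertexForm_of_ne hw.1]
      · rw [degreeOf_vertexForm_of_ne]
        rintro rfl
        exact hw.2 (hT w hu).1
    · have hvS : ∀ u ∈ S, G.Adj v u → vertexForm G v - vertexForm G u ∣ F := fun u hu h =>
        (Finset.dvd_prod_of_mem (fun u => vertexForm G v - vertexForm G u)
          (Finset.mem_filter.2 ⟨hu, h⟩)).mul_left P
      intro a ha b hb hab
      rcases Finset.mem_insert.1 ha with rfl | ha' <;> rcases Finset.mem_insert.1 hb with rfl | hb'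
      · exact absurd rfl hab.ne
      · exact hvS b hb' hab
      · rw [← neg_sub, neg_dvd]
        exact hvS a ha' hab.symm
      · exact (hdvd a ha' b hb' hab).mul_right _
    · intro u
      by_cases hu : u ∈ T
      · exact (h2 u hu).1
      · rw [hf _ fun w hw => ⟨by rintro ⟨⟩; exact hu hw, by simp⟩]
        exact hK1 u
    · intro e
      by_cases he : ∃ u ∈ T, e = s(v, u)
      · obtain ⟨u, hu, rfl⟩ := he
        exact (h2 u hu).2
      · push Not at he
        rw [hf _ fun w hw => ⟨by simp, by simpa using he w hw⟩]
        exact hK2 e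
    · intro a b h
      by_cases he : ∃ u ∈ T, s(a, b) = s(v, u)
      · obtain ⟨u, hu, he⟩ := he
        have := (hT u hu).1
        rcases Sym2.eq_iff.1 he with ⟨rfl, rfl⟩ | ⟨rfl, rfl⟩ <;> simp [this]
      · push Not at he
        rw [hf _ fun w hw => ⟨by simp, by simpa using he w hw⟩] at h
        have := hKS a b h
        simp [this]

open Classical in
/-- Finite graphs are `(2, 3)`-choosable. -/
theorem exists_weighting_of_fintype (LV : V → Finset ℚ) (LE : Sym2 V → Finset ℚ)
    (hV : ∀ v, 2 ≤ (LV v).card) (hE : ∀ e, 3 ≤ (LE e).card) :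
    ∃ (a : V → ℚ) (b : Sym2 V → ℚ), (∀ v, a v ∈ LV v) ∧ (∀ e, b e ∈ LE e) ∧
      ∀ u v, G.Adj u v →
        a u + ∑ w with G.Adj u w, b s(u, w) ≠ a v + ∑ w with G.Adj v w, b s(v, w) := by
  obtain ⟨P, K, ⟨n, hn⟩, -, -, hdvd, hK, hK1, hK2, -⟩ := exists_coeff_ne_zero G Finset.univ
  -- Homogeneity makes every monomial of `P` one of top degree.
  have hKn : K.degree = n := by
    by_contra h
    exact hK (hn.coeff_eq_zero h)
  obtain ⟨x, hx, hne⟩ := combinatorial_nullstellensatz_exists_eval_nonzero P K hK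
    (by rw [hn.totalDegree (by rintro rfl; simp at hK), hKn]) (Sum.elim LV LE) (by
      rintro (v | e)
      · exact (hK1 v).trans_lt (hV v)
      · exact (hK2 e).trans_lt (hE e))
  refine ⟨fun v => x (Sum.inl v), fun e => x (Sum.inr e), fun v => hx (Sum.inl v),
    fun e => hx (Sum.inr e), fun u v huv h => hne ?_⟩
  obtain ⟨R, rfl⟩ := hdvd u (Finset.mem_univ _) v (Finset.mem_univ _) huv
  rw [map_mul, map_sub]
  simp only [vertexForm, map_add, map_sum, eval_X]
  rw [h, sub_self, zero_mul]

end Finite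

/-! ### Infinite graphs: cardinal sums and compactness -/

section Infinite

variable {V : Type u} (G : SimpleGraph V)

theorem weightedDegree_of_finite (ωV : V → ℕ) (b : Sym2 V → ℕ) {v : V}
    (hv : (G.neighborSet v).Finite) :
    weightedDegree G ωV (fun e => b e) v =
      ((∑ w ∈ hv.toFinset, b s(v, w) + ωV v : ℕ) : Cardinal.{u}) := by
  have := hv.fintype
  have hs : ∑ w ∈ hv.toFinset, b s(v, w) = ∑ w : G.neighborSet v, b s(v, w) :=
    Finset.sum_subtype _ (fun w => hv.mem_toFinset) _
  have e : ∀ n : ℕ, (n : Cardinal.{u}) = #(ULift.{u} (Fin n)) := fun n => by simp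
  simp only [weightedDegree]
  rw [Nat.cast_add, funext fun w : G.neighborSet v => e (b s(v, w)), ← Cardinal.mk_sigma,
    Cardinal.mk_fintype, Fintype.card_sigma, hs]
  simp

/-- The edge sum lies between `κ` and `κ * ℵ₀ = κ`, where `κ` is the degree, and adding a finite
vertex weight changes nothing. -/
theorem weightedDegree_of_infinite (ωV : V → ℕ) (ωE : G.edgeSet → ℕ) (h1 : ∀ e, 1 ≤ ωE e) {v : V}
    (hv : ℵ₀ ≤ degree G v) : weightedDegree G ωV ωE v = degree G v := by
  have hsum : Cardinal.sum (fun w : G.neighborSet v =>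
      (ωE ⟨s(v, w.1), (G.mem_edgeSet).2 w.2⟩ : Cardinal.{u})) = degree G v := by
    apply le_antisymm
    · refine (Cardinal.sum_le_sum _ (fun _ => ℵ₀) fun w => (natCast_lt_aleph0).le).trans ?_
      rw [Cardinal.sum_const']
      exact (Cardinal.mul_eq_left hv hv aleph0_ne_zero).le
    · refine le_trans ?_ (Cardinal.sum_le_sum (fun _ => 1) _ fun w => ?_)
      · rw [Cardinal.sum_const', mul_one]
        rfl
      · exact_mod_cast h1 _
  rw [weightedDegree, hsum]
  exact Cardinal.add_eq_left hv (natCast_lt_aleph0.le.trans hv)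

/-- Vertices of finite degree in a finite set can be distinguished from their neighbours in it. -/
theorem exists_weighting_on_finset (LV : V → Finset ℕ) (LE : Sym2 V → Finset ℕ)
    (hV : ∀ v, 2 ≤ (LV v).card) (hE : ∀ e, 3 ≤ (LE e).card) (S : Finset V)
    (hS : ∀ v ∈ S, (G.neighborSet v).Finite) :
    ∃ (ωV : V → ℕ) (b : Sym2 V → ℕ), (∀ v, ωV v ∈ LV v) ∧ (∀ e, b e ∈ LE e) ∧
      ∀ u (hu : u ∈ S) v (hv : v ∈ S), G.Adj u v →
        ∑ w ∈ (hS u hu).toFinset, b s(u, w) + ωV u ≠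
          ∑ w ∈ (hS v hv).toFinset, b s(v, w) + ωV v := by
  classical
  have hE0 : ∀ e, ∃ n, n ∈ LE e := fun e => Finset.card_pos.1 (by linarith [hE e])
  have hV0 : ∀ v, ∃ n, n ∈ LV v := fun v => Finset.card_pos.1 (by linarith [hV v])
  choose b₀ hb₀ using hE0
  -- Edges leaving `S` are frozen at `b₀`. Their contribution `c u` is absorbed by shifting the list
  -- of `u`, which keeps its size.
  let c : S → ℚ := fun u => ∑ w ∈ (hS u u.2).toFinset with w ∉ S, (b₀ s(u, w) : ℚ)
  obtain ⟨a, b, ha, hb, hab⟩ := exists_weighting_of_fintype (G.induce (S : Set V))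
    (fun u => (LV u).image fun n : ℕ => (n : ℚ) + c u)
    (fun e => (LE (e.map Subtype.val)).image fun n : ℕ => (n : ℚ))
    (fun u => by
      rw [Finset.card_image_of_injective _ fun m n h => by simpa using h]
      exact hV u)
    (fun e => by
      rw [Finset.card_image_of_injective _ Nat.cast_injective]
      exact hE _)
  have hωV : ∀ v, ∃ n ∈ LV v, ∀ h : v ∈ S, (n : ℚ) + c ⟨v, h⟩ = a ⟨v, h⟩ := by
    intro v
    by_cases h : v ∈ S
    · obtain ⟨n, hn, hna⟩ := Finset.mem_image.1 (ha ⟨v, h⟩)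
      exact ⟨n, hn, fun _ => hna⟩
    · obtain ⟨n, hn⟩ := hV0 v
      exact ⟨n, hn, fun h' => absurd h' h⟩
  have hωE : ∀ e, ∃ n ∈ LE e, (∀ e' : Sym2 (S : Set V), e'.map Subtype.val = e → (n : ℚ) = b e') ∧
      ((∀ e' : Sym2 (S : Set V), e'.map Subtype.val ≠ e) → n = b₀ e) := by
    intro e
    by_cases h : ∃ e' : Sym2 (S : Set V), e'.map Subtype.val = e
    · obtain ⟨e', rfl⟩ := h
      obtain ⟨n, hn, hnb⟩ := Finset.mem_image.1 (hb e')
      refine ⟨n, hn, fun e'' he => ?_, fun h => absurd rfl (h e')⟩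
      rw [Sym2.map.injective Subtype.val_injective he]
      exact hnb
    · push Not at h
      exact ⟨b₀ e, hb₀ e, fun e' he => absurd he (h e'), fun _ => rfl⟩
  choose ωV hωV hωVa using hωV
  choose β hβ hβb hβ₀ using hωE
  refine ⟨ωV, β, hωV, hβ, ?_⟩
  have key : ∀ u (hu : u ∈ S),
      ((∑ w ∈ (hS u hu).toFinset, β s(u, w) + ωV u : ℕ) : ℚ) =
        a ⟨u, hu⟩ + ∑ w with (G.induce (S : Set V)).Adj ⟨u, hu⟩ w, b s(⟨u, hu⟩, w) := by
    intro u hu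
    rw [← hωVa u hu, ← Finset.sum_filter_add_sum_filter_not _ (· ∈ S)]
    have e1 : ∑ w ∈ (hS u hu).toFinset with w ∉ S, β s(u, w) =
        ∑ w ∈ (hS u hu).toFinset with w ∉ S, b₀ s(u, w) := by
      refine Finset.sum_congr rfl fun w hw => hβ₀ _ ?_
      rintro e' he
      refine (Finset.mem_filter.1 hw).2 ?_
      have hw' : w ∈ e'.map Subtype.val := by rw [he]; simp
      obtain ⟨x, -, rfl⟩ := Sym2.mem_map.1 hw'
      exact x.2
    have e2 : ∑ w with (G.induce (S : Set V)).Adj ⟨u, hu⟩ w, b s(⟨u, hu⟩, w) =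
        ∑ w ∈ (hS u hu).toFinset with w ∈ S, (β s(u, w) : ℚ) := by
      refine Finset.sum_bij (fun w _ => w.1) ?_ ?_ ?_ ?_
      · intro w hw
        have hw := (Finset.mem_filter.1 hw).2
        exact Finset.mem_filter.2 ⟨(hS u hu).mem_toFinset.2 hw, w.2⟩
      · intro x _ y _ h
        exact Subtype.ext h
      · intro w hw
        simp only [Finset.mem_filter, Set.Finite.mem_toFinset] at hw
        exact ⟨⟨w, hw.2⟩, by simpa using hw.1, rfl⟩
      · intro w _
        exact (hβb _ s(⟨u, hu⟩, w) rfl).symm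
    rw [e1, e2]
    push_cast
    ring
  intro u hu v hv huv h
  refine hab ⟨u, hu⟩ ⟨v, hv⟩ huv ?_
  convert (key u hu).symm.trans ((congrArg Nat.cast h).trans (key v hv))

/-- Vertices of finite degree can be distinguished from all their neighbours of finite degree. -/
theorem exists_weighting_finite_degree (LV : V → Finset ℕ) (LE : Sym2 V → Finset ℕ)
    (hV : ∀ v, 2 ≤ (LV v).card) (hE : ∀ e, 3 ≤ (LE e).card) :
    ∃ (ωV : V → ℕ) (b : Sym2 V → ℕ), (∀ v, ωV v ∈ LV v) ∧ (∀ e, b e ∈ LE e) ∧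
      ∀ u v (hu : (G.neighborSet u).Finite) (hv : (G.neighborSet v).Finite), G.Adj u v →
        ∑ w ∈ hu.toFinset, b s(u, w) + ωV u ≠ ∑ w ∈ hv.toFinset, b s(v, w) + ωV v := by
  classical
  let S : Finset (V ⊕ Sym2 V) → Finset V := fun t =>
    t.toLeft.filter fun v => (G.neighborSet v).Finite
  have hS : ∀ t, ∀ v ∈ S t, (G.neighborSet v).Finite := fun t v hv => (Finset.mem_filter.1 hv).2
  choose f g hf hg hfg using fun t => exists_weighting_on_finset G LV LE hV hE (S t) (hS t)
  let L : V ⊕ Sym2 V → Finset ℕ := Sum.elim LV LE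
  obtain ⟨χ, hχ⟩ := Finset.rado_selection (β := fun z => L z) fun t z =>
    match z with
    | Sum.inl v => ⟨f t v, hf t v⟩
    | Sum.inr e => ⟨g t e, hg t e⟩
  refine ⟨fun v => χ (Sum.inl v), fun e => χ (Sum.inr e), fun v => (χ (Sum.inl v)).2,
    fun e => (χ (Sum.inr e)).2, fun u v hu hv huv => ?_⟩
  -- Both weighted degrees depend only on the two endpoints and their finitely many edges.
  obtain ⟨t, hst, ht⟩ := hχ ({Sum.inl u, Sum.inl v} ∪ hu.toFinset.image (fun w => Sum.inr s(u, w)) ∪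
    hv.toFinset.image (fun w => Sum.inr s(v, w)))
  have hut : u ∈ S t := Finset.mem_filter.2 ⟨by simpa using hst (by simp), hu⟩
  have hvt : v ∈ S t := Finset.mem_filter.2 ⟨by simpa using hst (by simp), hv⟩
  have h := hfg t u hut v hvt huv
  have hsum : ∀ x (hx : (G.neighborSet x).Finite), (x = u ∨ x = v) →
      ∑ w ∈ hx.toFinset, (χ (Sum.inr s(x, w)) : ℕ) + χ (Sum.inl x) =
        ∑ w ∈ hx.toFinset, g t s(x, w) + f t x := by
    intro x hx hxuv
    congr 1
    · refine Finset.sum_congr rfl fun w hw => ?_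
      rw [ht]
      rcases hxuv with rfl | rfl
      · exact Finset.mem_union_left _ (Finset.mem_union_right _ (Finset.mem_image_of_mem _ hw))
      · exact Finset.mem_union_right _ (Finset.mem_image_of_mem _ hw)
    · rw [ht]
      rcases hxuv with rfl | rfl <;> simp
  rw [hsum u hu (Or.inl rfl), hsum v hv (Or.inr rfl)]
  exact h

end Infinite

end ListWeighting

theorem theorem4 {V : Type u} (G : SimpleGraph V) (k : ℕ)
    (LV : V → Finset ℕ) (LE : G.edgeSet → Finset ℕ)
    (hLV : ∀ v, LV v ⊆ Finset.Icc 1 k) (hLE : ∀ e, LE e ⊆ Finset.Icc 1 k)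
    (hV : ∀ v, 2 ≤ (LV v).card) (hE : ∀ e, 3 ≤ (LE e).card) :
    ListWeighting.HasListWeighting G LV LE := by
  classical
  -- Non-edges get the dummy list `Finset.range 3`, only to meet the size condition.
  obtain ⟨ωV, b, hωV, hb, hne⟩ := ListWeighting.exists_weighting_finite_degree G LV
    (fun e => if h : e ∈ G.edgeSet then LE ⟨e, h⟩ else Finset.range 3) hV (by
      intro e
      by_cases h : e ∈ G.edgeSet
      · simpa only [h, dif_pos] using hE ⟨e, h⟩
      · simp [h])
  have hbE : ∀ e : G.edgeSet, b e ∈ LE e := fun e => by simpa using hb e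
  refine ⟨ωV, fun e => b e, ⟨hωV, hbE⟩, fun u v huv => ?_⟩
  have hfin : ∀ x, ¬ ℵ₀ ≤ ListWeighting.degree G x → (G.neighborSet x).Finite := fun x hx =>
    Cardinal.lt_aleph0_iff_set_finite.1 (not_le.1 hx)
  have hinf : ∀ x, ℵ₀ ≤ ListWeighting.degree G x →
      ListWeighting.weightedDegree G ωV (fun e => b e) x = ListWeighting.degree G x := fun x =>
    ListWeighting.weightedDegree_of_infinite G ωV _ fun e => (Finset.mem_Icc.1 (hLE e (hbE e))).1
  by_cases hu : ℵ₀ ≤ ListWeighting.degree G u <;> by_cases hv : ℵ₀ ≤ ListWeighting.degree G v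
  · rw [hinf u hu, hinf v hv]
    exact (ne_or_eq _ _).imp_right fun h => ⟨h, hu⟩
  · rw [hinf u hu, ListWeighting.weightedDegree_of_finite G ωV b (hfin v hv)]
    exact Or.inl (natCast_lt_aleph0.trans_le hu).ne'
  · rw [hinf v hv, ListWeighting.weightedDegree_of_finite G ωV b (hfin u hu)]
    exact Or.inl (natCast_lt_aleph0.trans_le hv).ne
  · rw [ListWeighting.weightedDegree_of_finite G ωV b (hfin u hu),
      ListWeighting.weightedDegree_of_finite G ωV b (hfin v hv)]
    exact Or.inl (Nat.cast_injective.ne (hne u v (hfin u hu) (hfin v hv) huv))
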